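/- All graphs are finite, simple and undirected. A \emph{polyhedron} is a planar, $3$-connected graph, where a graph is $k$-connected if it has at least $k+1$ vertices and remains connected whenever fewer than $k$ vertices are removed. For a graph $G$ and vertices $u,v$ let $N(u,v)$ be the set of common neighbours of $u$ and $v$, and let \[A(G)=\{\,|N(u,v)| : u,v\in V(G),\ u\neq v\,\}.\] \textbf{Proposition.} For every finite non-empty set $A'_5$ of integers $\geq 5$, there are infinitely many pairwise non-isomorphic polyhedra $G$ satisfying \[A(G)=\{1,2,4\}\cup A'_5.\] -/

import Mathlib

namespace SimpleGraph

/-- A graph is planar if it can be drawn in the plane so that edges meet only at vertices: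
the vertices are placed at pairwise distinct points `p v`, and each edge `e` is drawn as a simple
arc `γ e` joining the positions of its two ends, which passes through no other vertex position,
and two different edges have no point in common other than the position of a common end. -/
def IsPlanar {V : Type*} (G : SimpleGraph V) : Prop :=
  ∃ (p : V → ℝ × ℝ) (γ : Sym2 V → C(unitInterval, ℝ × ℝ)),
    Function.Injective p ∧
    (∀ e ∈ G.edgeSet, Function.Injective (γ e)) ∧
    (∀ e ∈ G.edgeSet, s(γ e 0, γ e 1) = e.map p) ∧
    (∀ e ∈ G.edgeSet, ∀ v : V, p v ∈ Set.range (γ e) → v ∈ e) ∧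
    (∀ e ∈ G.edgeSet, ∀ e' ∈ G.edgeSet, e ≠ e' →
      ∀ x ∈ Set.range (γ e) ∩ Set.range (γ e'), ∃ v : V, v ∈ e ∧ v ∈ e' ∧ p v = x)

/-- A finite graph is `k`-connected if it has at least `k + 1` vertices and removing fewer than
`k` of them always leaves a connected graph. -/
def IsKConnected {V : Type*} [Fintype V] (G : SimpleGraph V) (k : ℕ) : Prop :=
  k + 1 ≤ Fintype.card V ∧
    ∀ S : Finset V, S.card < k → (G.induce ((S : Set V)ᶜ)).Connected

/-- A polyhedron: a planar, 3-connected finite simple graph. -/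
def IsPolyhedron {V : Type*} [Fintype V] (G : SimpleGraph V) : Prop :=
  G.IsPlanar ∧ G.IsKConnected 3

/-- The type `A(G)` of a finite graph: the set of the numbers of common neighbours of the pairs
of distinct vertices. -/
def commonNeighborType {V : Type*} [Fintype V] (G : SimpleGraph V) : Set ℕ :=
  {a | ∃ u v : V, u ≠ v ∧ (G.commonNeighbors u v).ncard = a}

end SimpleGraph

open SimpleGraph

/-! Let `H` be an outerplanar graph with a Hamiltonian cycle and without triangles and 4-cycles, and
join a new hub to all its vertices. This cone is a polyhedron. The hub and a vertex `v` have `deg v`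
common neighbours. Two vertices of `H` have the hub in common and at most one vertex of `H`, so they
contribute only 1 and 2 (`commonNeighborType_cone`). It remains to find such `H`, of infinitely many
orders, with degree set `{2, 4} ∪ A'`; the difficulty is to avoid degree 3.

`H` is built from arcs, that is, outerplanar pieces with two marked ends on the outer path.
Concatenating arcs adds the degrees at the shared end. An edge closing an arc adds 1 to both end
degrees, and creates no short cycle if the ends are at distance at least 4. Four arcs in a row,
closed by an edge, therefore always give an arc (`face`). Iterating this raises the degree of one
end at will while all inner degrees stay in `{2, 4}` (`odd_three'`), and concatenation then collects
the degrees in `A'`. -/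

/-- `G` is a graph on `{0, …, n}` containing the path `0, 1, …, n`, with no two crossing edges
(with respect to the order), no triangle and no 4-cycle. The end vertices have degrees `a` and `b`
and `S` is the set of the degrees of the inner vertices; the distance of the ends is at least `m`, as
witnessed by a function changing by at most one along the edges. -/
structure IsArc (S : Set ℕ) (m n a b : ℕ) (G : SimpleGraph ℕ) : Prop where
  pos : 0 < n
  le : ∀ {i j}, G.Adj i j → i ≤ n
  path : ∀ i < n, G.Adj i (i + 1)
  noncrossing : ∀ {i j k l}, G.Adj i j → G.Adj k l → i < k → k < j → j < l → False
  triangle : ∀ {u v w}, G.Adj u v → G.Adj v w → G.Adj u w → False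
  square : ∀ {u w x y}, G.Adj u x → G.Adj u y → G.Adj w x → G.Adj w y → u ≠ w → x = y
  left : (G.neighborSet 0).ncard = a
  right : (G.neighborSet n).ncard = b
  inner : (fun i => (G.neighborSet i).ncard) '' Set.Ioo 0 n = S
  dist : ∃ f : ℕ → ℕ, f 0 = 0 ∧ m ≤ f n ∧ ∀ i j, G.Adj i j → f j ≤ f i + 1

/-! ### Concatenating and closing arcs. -/

namespace IsArc

variable {S S₁ S₂ : Set ℕ} {m n a b m₁ n₁ a₁ b₁ m₂ n₂ a₂ b₂ : ℕ} {G G₁ G₂ : SimpleGraph ℕ}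

theorem le' (h : IsArc S m n a b G) {i j : ℕ} (hij : G.Adj i j) : j ≤ n := h.le hij.symm

theorem finite_neighborSet (h : IsArc S m n a b G) (i : ℕ) : (G.neighborSet i).Finite :=
  (Set.finite_Iic n).subset fun _ hj => h.le' hj

theorem weaken (h : IsArc S m n a b G) {m' : ℕ} (hm : m' ≤ m) : IsArc S m' n a b G :=
  let ⟨f, h0, hn, hf⟩ := h.dist
  { h with dist := ⟨f, h0, hm.trans hn, hf⟩ }

/-- The arc consisting of one edge. -/
theorem single : IsArc ∅ 1 1 1 1 (SimpleGraph.edge 0 1) := by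
  have hadj : ∀ i j, (SimpleGraph.edge 0 1).Adj i j ↔ (i = 0 ∧ j = 1 ∨ i = 1 ∧ j = 0) := by
    intro i j
    rw [SimpleGraph.edge_adj]
    omega
  have h0 : (SimpleGraph.edge 0 1).neighborSet 0 = {1} := by
    ext j; simp [hadj]
  have h1 : (SimpleGraph.edge 0 1).neighborSet 1 = {0} := by
    ext j; simp [hadj]
  refine ⟨one_pos, ?_, ?_, ?_, ?_, ?_, ?_, ?_, ?_, fun i => i, rfl, le_rfl, ?_⟩
  any_goals (simp only [hadj]; intros; omega)
  · rw [h0, Set.ncard_singleton]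
  · rw [h1, Set.ncard_singleton]
  · rw [Set.image_eq_empty, Set.eq_empty_iff_forall_notMem]
    rintro x ⟨hx, hx'⟩
    omega

/-- Joining the ends of an arc by an edge. -/
theorem close (h : IsArc S m n a b G) (hm : 4 ≤ m) :
    IsArc S 1 n (a + 1) (b + 1) (G ⊔ SimpleGraph.edge 0 n) := by
  have hpos := h.pos
  have hadj : ∀ i j, (G ⊔ SimpleGraph.edge 0 n).Adj i j ↔
      (G.Adj i j ∨ i = 0 ∧ j = n ∨ i = n ∧ j = 0) := by
    intro i j
    rw [SimpleGraph.sup_adj, SimpleGraph.edge_adj]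
    have : (i = 0 ∧ j = n ∨ i = n ∧ j = 0) → i ≠ j := by omega
    tauto
  obtain ⟨f, f0, fn, hf⟩ := h.dist
  have hle := @le _ _ _ _ _ _ h
  have hle' := @le' _ _ _ _ _ _ h
  have h0n : ¬ G.Adj 0 n := fun h' => by have := hf _ _ h'; omega
  have hinner : ∀ i ∈ Set.Ioo 0 n,
      (G ⊔ SimpleGraph.edge 0 n).neighborSet i = G.neighborSet i := by
    rintro i ⟨hi, hi'⟩
    ext j
    simp only [SimpleGraph.mem_neighborSet, hadj]
    have : ¬ (i = 0 ∧ j = n ∨ i = n ∧ j = 0) := by omega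
    tauto
  have hl : (G ⊔ SimpleGraph.edge 0 n).neighborSet 0 = insert n (G.neighborSet 0) := by
    ext j
    simp only [SimpleGraph.mem_neighborSet, hadj, Set.mem_insert_iff]
    have : ¬ (0 = n ∧ j = 0) := by omega
    tauto
  have hr : (G ⊔ SimpleGraph.edge 0 n).neighborSet n = insert 0 (G.neighborSet n) := by
    ext j
    simp only [SimpleGraph.mem_neighborSet, hadj, Set.mem_insert_iff]
    have : ¬ (n = 0 ∧ j = n) := by omega
    tauto
  -- A triangle or 4-cycle through the new edge would leave a walk of length 2 or 3 between the ends
  -- in `G`, which `f n ≥ 4` forbids.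
  have key : ∀ {x y z w : ℕ}, G.Adj x y → G.Adj y z → G.Adj z w → x = 0 → w = n → False := by
    intro x y z w h1 h2 h3 hx hw
    have := hf _ _ h1
    have := hf _ _ h2
    have := hf _ _ h3
    subst hx hw
    omega
  have key2 : ∀ {x y z : ℕ}, G.Adj x y → G.Adj y z → x = 0 → z = n → False := by
    intro x y z h1 h2 hx hw
    have := hf _ _ h1
    have := hf _ _ h2
    subst hx hw
    omega
  refine ⟨hpos, ?_, ?_, ?_, ?_, ?_, ?_, ?_, ?_, fun i => if i = 0 then 0 else 1, by simp, by
    simp [hpos.ne'], ?_⟩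
  · intro i j hij
    rcases (hadj _ _).1 hij with h' | h'
    · exact h.le h'
    · omega
  · exact fun i hi => (hadj _ _).2 (Or.inl (h.path i hi))
  · intro i j k l hij hkl h1 h2 h3
    rcases (hadj _ _).1 hij with hij | hij <;> rcases (hadj _ _).1 hkl with hkl | hkl
    · exact h.noncrossing hij hkl h1 h2 h3
    · have := hle hij
      have := hle' hij
      omega
    · have := hle hkl
      have := hle' hkl
      omega
    · omega
  · intro u v w h1 h2 h3
    rcases (hadj _ _).1 h1 with h1 | h1 <;> rcases (hadj _ _).1 h2 with h2 | h2 <;>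
      rcases (hadj _ _).1 h3 with h3 | h3
    · exact h.triangle h1 h2 h3
    · rcases h3 with ⟨h3, h4⟩ | ⟨h3, h4⟩
      · exact key2 h1 h2 h3 h4
      · exact key2 h2.symm h1.symm h4 h3
    · rcases h2 with ⟨h2, h4⟩ | ⟨h2, h4⟩
      · exact key2 h1.symm h3 h2 h4
      · exact key2 h3.symm h1 h4 h2
    · have := h1.ne; omega
    · rcases h1 with ⟨h1, h4⟩ | ⟨h1, h4⟩
      · exact key2 h3 h2.symm h1 h4
      · exact key2 h2 h3.symm h4 h1
    · have := h2.ne; omega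
    · have := h3.ne; omega
    · omega
  · intro u w x y h1 h2 h3 h4 huw
    by_contra hxy
    rcases (hadj _ _).1 h1 with h1 | h1 <;> rcases (hadj _ _).1 h2 with h2 | h2 <;>
      rcases (hadj _ _).1 h3 with h3 | h3 <;> rcases (hadj _ _).1 h4 with h4 | h4
    · exact hxy (h.square h1 h2 h3 h4 huw)
    · rcases h4 with ⟨h4, h5⟩ | ⟨h4, h5⟩
      · exact key h3 h1.symm h2 h4 h5
      · exact key h2.symm h1 h3.symm h5 h4
    · rcases h3 with ⟨h3, h5⟩ | ⟨h3, h5⟩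
      · exact key h4 h2.symm h1 h3 h5
      · exact key h1.symm h2 h4.symm h5 h3
    · omega
    · rcases h2 with ⟨h2, h5⟩ | ⟨h2, h5⟩
      · exact key h1 h3.symm h4 h2 h5
      · exact key h4.symm h3 h1.symm h5 h2
    · omega
    · have := h1.ne; have := h4.ne; omega
    · omega
    · rcases h1 with ⟨h1, h5⟩ | ⟨h1, h5⟩
      · exact key h2 h4.symm h3 h1 h5
      · exact key h3.symm h4 h2.symm h5 h1
    · have := h2.ne; have := h3.ne; omega
    all_goals omega
  · rw [hl, Set.ncard_insert_of_notMem (by exact h0n) (h.finite_neighborSet _), h.left]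
  · rw [hr, Set.ncard_insert_of_notMem (by exact fun h' => h0n h'.symm) (h.finite_neighborSet _),
      h.right]
  · rw [← h.inner]
    exact Set.image_congr fun i hi => by rw [hinner i hi]
  · intro i j _
    dsimp only
    split_ifs <;> omega

/-- The concatenation of two arcs, sharing an end. -/
theorem append (h₁ : IsArc S₁ m₁ n₁ a₁ b₁ G₁) (h₂ : IsArc S₂ m₂ n₂ a₂ b₂ G₂) :
    IsArc (S₁ ∪ S₂ ∪ {b₁ + a₂}) (m₁ + m₂) (n₁ + n₂) a₁ b₂
      (G₁ ⊔ G₂.map (addLeftEmbedding n₁)) := by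
  set G := G₁ ⊔ G₂.map (addLeftEmbedding n₁) with hG
  have hadj' : ∀ i j, G.Adj i j ↔ (G₁.Adj i j ∨ ∃ i' j', G₂.Adj i' j' ∧ n₁ + i' = i ∧
      n₁ + j' = j) := by
    intro i j
    simp [hG, SimpleGraph.map_adj]
  have hpos₁ := h₁.pos
  have hpos₂ := h₂.pos
  have hle₁ := @le _ _ _ _ _ _ h₁
  have hle₁' := @le' _ _ _ _ _ _ h₁
  -- The two parts share only the vertex `n₁`. With the inequalities and `i ≠ j` recorded here,
  -- `omega` disposes of every configuration that mixes edges of both parts.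
  have hadj : ∀ i j, G.Adj i j → (i ≤ n₁ ∧ j ≤ n₁ ∧ i ≠ j ∧ G₁.Adj i j) ∨
      (n₁ ≤ i ∧ n₁ ≤ j ∧ i ≤ n₁ + n₂ ∧ i ≠ j ∧ G₂.Adj (i - n₁) (j - n₁)) := by
    intro i j hij
    rcases (hadj' _ _).1 hij with h | ⟨i', j', h, rfl, rfl⟩
    · exact Or.inl ⟨h₁.le h, h₁.le' h, h.ne, h⟩
    · refine Or.inr ⟨by omega, by omega, ?_, hij.ne, by simpa using h⟩
      have := h₂.le h
      omega
  have hN₁ : ∀ i < n₁, G.neighborSet i = G₁.neighborSet i := by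
    intro i hi
    ext j
    simp only [SimpleGraph.mem_neighborSet, hadj']
    refine ⟨?_, Or.inl⟩
    rintro (h | ⟨i', j', h, rfl, rfl⟩)
    · exact h
    · omega
  have hN₂ : ∀ i, 0 < i → G.neighborSet (n₁ + i) = (n₁ + ·) '' G₂.neighborSet i := by
    intro i hi
    ext j
    simp only [SimpleGraph.mem_neighborSet, hadj', Set.mem_image]
    constructor
    · rintro (h | ⟨i', j', h, hi', rfl⟩)
      · have := h₁.le h
        omega
      · obtain rfl : i' = i := by omega
        exact ⟨j', h, rfl⟩
    · rintro ⟨j', h, rfl⟩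
      exact Or.inr ⟨i, j', h, rfl, rfl⟩
  have hN : G.neighborSet n₁ = G₁.neighborSet n₁ ∪ (n₁ + ·) '' G₂.neighborSet 0 := by
    ext j
    simp only [SimpleGraph.mem_neighborSet, hadj', Set.mem_image, Set.mem_union]
    refine or_congr Iff.rfl ?_
    constructor
    · rintro ⟨i', j', h, hi', rfl⟩
      obtain rfl : i' = 0 := by omega
      exact ⟨j', h, rfl⟩
    · rintro ⟨j', h, rfl⟩
      exact ⟨0, j', h, rfl, rfl⟩
  have hd₂ : ∀ i, 0 < i → (G.neighborSet (n₁ + i)).ncard = (G₂.neighborSet i).ncard := by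
    intro i hi
    rw [hN₂ i hi, Set.ncard_image_of_injective _ (add_right_injective n₁)]
  have hd : (G.neighborSet n₁).ncard = b₁ + a₂ := by
    rw [hN, Set.ncard_union_eq _ (h₁.finite_neighborSet _) ((h₂.finite_neighborSet _).image _),
      Set.ncard_image_of_injective _ (add_right_injective n₁), h₁.right, h₂.left]
    rw [Set.disjoint_left]
    rintro j hj ⟨j', hj', rfl⟩
    have h1 := h₁.le' hj
    have h2 := SimpleGraph.Adj.ne hj'
    dsimp only at h1
    omega
  refine ⟨by omega, ?_, ?_, ?_, ?_, ?_, ?_, ?_, ?_, ?_⟩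
  · intro i j hij
    rcases hadj _ _ hij with h | h <;> omega
  · intro i hi
    rw [hadj']
    by_cases h : i < n₁
    · exact Or.inl (h₁.path i h)
    · exact Or.inr ⟨i - n₁, i - n₁ + 1, h₂.path _ (by omega), by omega, by omega⟩
  · intro i j k l hij hkl h1 h2 h3
    rcases hadj _ _ hij with hij | hij <;> rcases hadj _ _ hkl with hkl | hkl
    · exact h₁.noncrossing hij.2.2.2 hkl.2.2.2 h1 h2 h3
    · omega
    · omega
    · exact h₂.noncrossing hij.2.2.2.2 hkl.2.2.2.2 (by omega) (by omega) (by omega)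
  · intro u v w h1 h2 h3
    rcases hadj _ _ h1 with h1 | h1 <;> rcases hadj _ _ h2 with h2 | h2 <;>
      rcases hadj _ _ h3 with h3 | h3
    · exact h₁.triangle h1.2.2.2 h2.2.2.2 h3.2.2.2
    any_goals omega
    exact h₂.triangle h1.2.2.2.2 h2.2.2.2.2 h3.2.2.2.2
  · intro u w x y h1 h2 h3 h4 huw
    rcases hadj _ _ h1 with h1 | h1 <;> rcases hadj _ _ h2 with h2 | h2 <;>
      rcases hadj _ _ h3 with h3 | h3 <;> rcases hadj _ _ h4 with h4 | h4
    · exact h₁.square h1.2.2.2 h2.2.2.2 h3.2.2.2 h4.2.2.2 huw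
    any_goals omega
    have := h₂.square h1.2.2.2.2 h2.2.2.2.2 h3.2.2.2.2 h4.2.2.2.2 (by omega)
    omega
  · rw [hN₁ 0 hpos₁, h₁.left]
  · rw [hd₂ n₂ hpos₂, h₂.right]
  · ext d
    simp only [Set.mem_image, Set.mem_Ioo, ← h₁.inner, ← h₂.inner, Set.mem_union,
      Set.mem_singleton_iff]
    constructor
    · rintro ⟨i, hi, rfl⟩
      rcases lt_trichotomy i n₁ with h | h | h
      · exact Or.inl (Or.inl ⟨i, ⟨hi.1, h⟩, by rw [hN₁ i h]⟩)
      · exact Or.inr (by rw [h, hd])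
      · obtain ⟨j, rfl⟩ := Nat.exists_eq_add_of_lt h
        refine Or.inl (Or.inr ⟨j + 1, ⟨by omega, by omega⟩, ?_⟩)
        rw [add_assoc, hd₂ _ (by omega)]
    · rintro ((⟨i, hi, rfl⟩ | ⟨i, hi, rfl⟩) | rfl)
      · exact ⟨i, ⟨hi.1, by omega⟩, by rw [hN₁ i hi.2]⟩
      · exact ⟨n₁ + i, ⟨by omega, by omega⟩, by rw [hd₂ i hi.1]⟩
      · exact ⟨n₁, ⟨hpos₁, by omega⟩, hd⟩
  · obtain ⟨f₁, hf₁, hfn₁, hf₁'⟩ := h₁.dist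
    obtain ⟨f₂, hf₂, hfn₂, hf₂'⟩ := h₂.dist
    refine ⟨fun i => if i ≤ n₁ then f₁ i else f₁ n₁ + f₂ (i - n₁), by simp [hf₁], ?_, ?_⟩
    · have : ¬ n₁ + n₂ ≤ n₁ := by omega
      simp only [if_neg this, Nat.add_sub_cancel_left]
      omega
    · have hr : ∀ i, n₁ ≤ i → (if i ≤ n₁ then f₁ i else f₁ n₁ + f₂ (i - n₁)) =
          f₁ n₁ + f₂ (i - n₁) := by
        intro i hi
        split_ifs with h
        · obtain rfl : i = n₁ := le_antisymm h hi
          simp [hf₂]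
        · rfl
      intro i j hij
      dsimp only
      rcases hadj _ _ hij with h | h
      · rw [if_pos h.1, if_pos h.2.1]
        exact hf₁' _ _ h.2.2.2
      · rw [hr _ h.1, hr _ h.2.1]
        have := hf₂' _ _ h.2.2.2.2
        omega

end IsArc

/-! ### Prescribing the degrees. -/

/-- Existence of an arc of some order, with ends at distance at least one. -/
def HasArc (S : Set ℕ) (a b : ℕ) : Prop :=
  ∃ n G, IsArc S 1 n a b G

namespace HasArc

variable {S S₁ S₂ S₃ S₄ : Set ℕ} {a b a₁ b₁ a₂ b₂ a₃ b₃ a₄ b₄ : ℕ}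

theorem single : HasArc ∅ 1 1 := ⟨_, _, IsArc.single⟩

theorem append (h₁ : HasArc S₁ a₁ b₁) (h₂ : HasArc S₂ a₂ b₂) :
    HasArc (S₁ ∪ S₂ ∪ {b₁ + a₂}) a₁ b₂ := by
  obtain ⟨n₁, G₁, h₁⟩ := h₁
  obtain ⟨n₂, G₂, h₂⟩ := h₂
  exact ⟨_, _, (h₁.append h₂).weaken (by omega)⟩

/-- Four consecutive arcs, closed by an edge. -/
theorem face (h₁ : HasArc S₁ a₁ b₁) (h₂ : HasArc S₂ a₂ b₂) (h₃ : HasArc S₃ a₃ b₃)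
    (h₄ : HasArc S₄ a₄ b₄) :
    HasArc (S₁ ∪ S₂ ∪ {b₁ + a₂} ∪ S₃ ∪ {b₂ + a₃} ∪ S₄ ∪ {b₃ + a₄}) (a₁ + 1) (b₄ + 1) := by
  obtain ⟨n₁, G₁, h₁⟩ := h₁
  obtain ⟨n₂, G₂, h₂⟩ := h₂
  obtain ⟨n₃, G₃, h₃⟩ := h₃
  obtain ⟨n₄, G₄, h₄⟩ := h₄
  -- Each arc contributes at least 1 to the distance of the ends, which makes the 4 needed by
  -- `close`.
  exact ⟨_, _, (((h₁.append h₂).append h₃).append h₄).close (by omega)⟩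

theorem congr (h : HasArc S₁ a b) (hS : S₁ = S₂) : HasArc S₂ a b := hS ▸ h

/-- The 5-cycle, with two adjacent vertices as ends. -/
theorem two_two : HasArc {2} 2 2 :=
  (face single single single single).congr (by ext; simp)

/-- All three joints have degree 2 + 2 = 4. Alternating with `even_two`, whose joints have degrees 3
+ 1 and 1 + 1, this raises the left degree step by step, while the right degree alternates between 2
and 3. -/
theorem odd_three (h : HasArc S a 2) (hS : S ⊆ {2, 4}) : HasArc {2, 4} (a + 1) 3 :=
  (face h two_two two_two two_two).congr (by
    ext x
    have := @hS x
    simp only [Set.mem_union, Set.mem_insert_iff, Set.mem_singleton_iff] at this ⊢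
    tauto)

theorem even_two (h : HasArc {2, 4} a 3) : HasArc {2, 4} (a + 1) 2 :=
  (face h single single single).congr (by
    ext x
    simp only [Set.mem_union, Set.mem_insert_iff, Set.mem_singleton_iff, Set.mem_empty_iff_false]
    tauto)

theorem three_odd (h : HasArc S 2 a) (hS : S ⊆ {2, 4}) : HasArc {2, 4} 3 (a + 1) :=
  (face two_two two_two two_two h).congr (by
    ext x
    have := @hS x
    simp only [Set.mem_union, Set.mem_insert_iff, Set.mem_singleton_iff] at this ⊢
    tauto)

theorem two_even (h : HasArc {2, 4} 3 a) : HasArc {2, 4} 2 (a + 1) :=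
  (face single single single h).congr (by
    ext x
    simp only [Set.mem_union, Set.mem_insert_iff, Set.mem_singleton_iff, Set.mem_empty_iff_false]
    tauto)

theorem odd_three' (k : ℕ) : HasArc {2, 4} (2 * k + 3) 3 ∧ HasArc {2, 4} 3 (2 * k + 3) := by
  induction k with
  | zero => exact ⟨two_two.odd_three (by simp), two_two.three_odd (by simp)⟩
  | succ k ih => exact ⟨ih.1.even_two.odd_three le_rfl, ih.2.two_even.three_odd le_rfl⟩

/-- An arc in which only the degrees `2`, `4` and `d` occur. -/
theorem of_degree {d : ℕ} (hd : 5 ≤ d) : HasArc {2, 4, d} 1 1 := by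
  obtain ⟨k, rfl | rfl⟩ := d.even_or_odd'
  -- For even `d`, an edge at each side turns the end degrees `d - 1` and 3 into inner degrees `d`
  -- and 4.
  · obtain ⟨k, rfl⟩ := Nat.exists_eq_add_of_le (show 2 ≤ k by omega)
    refine ((single.append (odd_three' k).1).append single).congr ?_
    rw [show 1 + (2 * k + 3) = 2 * (2 + k) by omega]
    ext x
    simp only [Set.mem_union, Set.mem_insert_iff, Set.mem_singleton_iff, Set.mem_empty_iff_false]
    tauto
  -- For odd `d`, the end opposite to the one of degree `d - 1` has degree 2, and a single edge
  -- there would produce degree 3. Gluing the mirror image gives 2 + 2 = 4 instead.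
  · obtain ⟨k, rfl⟩ := Nat.exists_eq_add_of_le (show 2 ≤ k by omega)
    refine ((single.append ((odd_three' k).1.even_two.append (odd_three' k).2.two_even)).append
      single).congr ?_
    rw [show 1 + (2 * k + 3 + 1) = 2 * (2 + k) + 1 by omega,
      show 2 * k + 3 + 1 + 1 = 2 * (2 + k) + 1 by omega]
    ext x
    simp only [Set.mem_union, Set.mem_insert_iff, Set.mem_singleton_iff, Set.mem_empty_iff_false]
    tauto

theorem of_finset (A : Finset ℕ) (hA : ∀ a ∈ A, 5 ≤ a) : HasArc ({2, 4} ∪ (A : Set ℕ)) 1 1 := by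
  induction A using Finset.induction_on with
  | empty =>
    refine ((single.append (odd_three' 0).1).append single).congr ?_
    ext x
    simp only [Set.mem_union, Set.mem_insert_iff, Set.mem_singleton_iff, Set.mem_empty_iff_false,
      Finset.coe_empty]
    tauto
  | insert a A _ ih =>
    refine ((of_degree (hA a (Finset.mem_insert_self a A))).append
      (ih fun b hb => hA b (Finset.mem_insert_of_mem hb))).congr ?_
    ext x
    simp only [Set.mem_union, Set.mem_insert_iff, Set.mem_singleton_iff, Finset.coe_insert]
    tauto

end HasArc

/-- Padding with a pendant path creates only inner vertices of degree 2. It provides both the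
distance needed for closing and arbitrarily large orders. -/
theorem IsArc.append_singles {S : Set ℕ} {m n a : ℕ} {G : SimpleGraph ℕ}
    (h : IsArc S m n a 1 G) (hS : 2 ∈ S) (t : ℕ) : ∃ G', IsArc S (m + t) (n + t) a 1 G' := by
  induction t with
  | zero => exact ⟨G, h⟩
  | succ t ih =>
    obtain ⟨G', h'⟩ := ih
    have hS' : S ∪ ∅ ∪ {1 + 1} = S := by simpa using hS
    exact ⟨_, hS' ▸ h'.append IsArc.single⟩

/-- There are closed arcs of every large order, in which exactly the degrees `2`, `4` and the
elements of `A` occur. -/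
theorem exists_isArc (A : Finset ℕ) (hA : ∀ a ∈ A, 5 ≤ a) :
    ∃ N, 4 ≤ N ∧ ∀ t, ∃ G, IsArc ({2, 4} ∪ (A : Set ℕ)) 1 (N + t) 2 2 G ∧ G.Adj 0 (N + t) := by
  obtain ⟨n, G, h⟩ := HasArc.of_finset A hA
  refine ⟨n + 4, by omega, fun t => ?_⟩
  obtain ⟨G', h'⟩ := h.append_singles (by simp) (4 + t)
  rw [← add_assoc n] at h'
  refine ⟨_, (h'.close (by omega)), ?_⟩
  rw [SimpleGraph.sup_adj, SimpleGraph.edge_adj]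
  exact Or.inr ⟨Or.inl ⟨rfl, rfl⟩, by omega⟩

/-! ### Straight-line drawings. -/

namespace SimpleGraph

/-- A straight-line drawing without crossings shows that a graph is planar. -/
theorem IsPlanar.of_segments {V : Type*} {G : SimpleGraph V} (p : V → ℝ × ℝ)
    (hp : Function.Injective p)
    (hv : ∀ a b, G.Adj a b → ∀ v, p v ∈ segment ℝ (p a) (p b) → v = a ∨ v = b)
    (he : ∀ a b c d, G.Adj a b → G.Adj c d → s(a, b) ≠ s(c, d) →
      ∀ x ∈ segment ℝ (p a) (p b), x ∈ segment ℝ (p c) (p d) →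
        ∃ v, (v = a ∨ v = b) ∧ (v = c ∨ v = d) ∧ p v = x) :
    G.IsPlanar := by
  have hout : ∀ e : Sym2 V, s((Quot.out e).1, (Quot.out e).2) = e := fun e => Quot.out_eq e
  have hadj : ∀ e ∈ G.edgeSet, G.Adj (Quot.out e).1 (Quot.out e).2 := by
    intro e h
    rwa [← hout e] at h
  have hmem : ∀ (e : Sym2 V) (v : V), v = (Quot.out e).1 ∨ v = (Quot.out e).2 → v ∈ e := by
    intro e v h
    rw [← hout e]
    exact Sym2.mem_iff.2 h
  let γ : Sym2 V → C(unitInterval, ℝ × ℝ) := fun e =>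
    ⟨fun t => AffineMap.lineMap (p (Quot.out e).1) (p (Quot.out e).2) (t : ℝ), by
      simp only [AffineMap.lineMap_apply_module]
      fun_prop⟩
  have hrange : ∀ e x, x ∈ Set.range (γ e) →
      x ∈ segment ℝ (p (Quot.out e).1) (p (Quot.out e).2) := by
    rintro e _ ⟨t, rfl⟩
    rw [segment_eq_image_lineMap]
    exact ⟨t, t.2, rfl⟩
  refine ⟨p, γ, hp, ?_, ?_, ?_, ?_⟩
  · intro e h s t hst
    exact Subtype.ext (AffineMap.lineMap_injective ℝ (hp.ne (hadj e h).ne) hst)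
  · intro e _
    conv_rhs => rw [← hout e]
    simp [γ]
  · exact fun e h v hx => hmem e v (hv _ _ (hadj e h) v (hrange e _ hx))
  · rintro e h e' h' hne x ⟨hx, hx'⟩
    obtain ⟨v, h1, h2, h3⟩ := he _ _ _ _ (hadj e h) (hadj e' h') (by rwa [hout, hout]) x
      (hrange e _ hx) (hrange e' _ hx')
    exact ⟨v, hmem e v h1, hmem e' v h2, h3⟩

end SimpleGraph

/-! ### Common neighbours and connectivity of the cone. -/

/-- The graph on `{0, …, n + 1}` arising from a graph on `{0, …, n}` by joining the new vertex
`n + 1` to all others. -/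
def coneGraph (H : SimpleGraph ℕ) (n : ℕ) : SimpleGraph (Fin (n + 2)) where
  Adj u v := H.Adj u v ∨ (u.val = n + 1 ∧ v.val ≤ n) ∨ (v.val = n + 1 ∧ u.val ≤ n)
  symm := ⟨fun u v h => by
    rcases h with h | h | h
    · exact Or.inl h.symm
    · exact Or.inr (Or.inr h)
    · exact Or.inr (Or.inl h)⟩
  loopless := ⟨fun u h => by
    rcases h with h | h | h
    · exact h.ne rfl
    all_goals omega⟩

namespace IsArc

variable {S : Set ℕ} {m n a b : ℕ} {H : SimpleGraph ℕ}

theorem cone_adj_last (h : IsArc S m n a b H) {u v : Fin (n + 2)} (hu : u.val = n + 1) :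
    (coneGraph H n).Adj u v ↔ v.val ≤ n := by
  constructor
  · rintro (h' | h' | h')
    · have := h.le h'
      omega
    all_goals omega
  · exact fun h' => Or.inr (Or.inl ⟨hu, h'⟩)

theorem cone_adj {u v : Fin (n + 2)} (hu : u.val ≤ n) :
    (coneGraph H n).Adj u v ↔ H.Adj u v ∨ v.val = n + 1 := by
  constructor
  · rintro (h' | h' | h')
    · exact Or.inl h'
    · omega
    · exact Or.inr h'.1
  · rintro (h' | h')
    · exact Or.inl h'
    · exact Or.inr (Or.inr ⟨h', hu⟩)

theorem ncard_commonNeighbors_last (h : IsArc S m n a b H) {u v : Fin (n + 2)}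
    (hu : u.val = n + 1) (hv : v.val ≤ n) :
    ((coneGraph H n).commonNeighbors u v).ncard = (H.neighborSet v).ncard := by
  rw [← Set.ncard_image_of_injective _ Fin.val_injective]
  congr 1
  ext x
  simp only [Set.mem_image, SimpleGraph.mem_commonNeighbors, SimpleGraph.mem_neighborSet,
    h.cone_adj_last hu, cone_adj hv]
  constructor
  · rintro ⟨w, ⟨hw, h' | h'⟩, rfl⟩
    · exact h'
    · omega
  · intro h'
    have := h.le' h'
    exact ⟨⟨x, by omega⟩, ⟨this, Or.inl h'⟩, rfl⟩

theorem ncard_commonNeighbors (h : IsArc S m n a b H) {u v : Fin (n + 2)}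
    (hu : u.val ≤ n) (hv : v.val ≤ n) :
    ((coneGraph H n).commonNeighbors u v).ncard = (H.commonNeighbors u v).ncard + 1 := by
  have hn : n + 1 ∉ H.commonNeighbors u v := fun h' => by
    have := h.le' h'.1
    omega
  have hfin : (H.commonNeighbors u v).Finite :=
    (h.finite_neighborSet u).subset Set.inter_subset_left
  rw [← Set.ncard_insert_of_notMem hn hfin, ← Set.ncard_image_of_injective _ Fin.val_injective]
  congr 1
  ext x
  simp only [Set.mem_image, SimpleGraph.mem_commonNeighbors, Set.mem_insert_iff,
    cone_adj hu, cone_adj hv]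
  constructor
  · rintro ⟨w, ⟨h1 | h1, h2 | h2⟩, rfl⟩
    · exact Or.inr ⟨h1, h2⟩
    all_goals exact Or.inl (by assumption)
  · rintro (rfl | ⟨h1, h2⟩)
    · exact ⟨Fin.last _, ⟨Or.inr rfl, Or.inr rfl⟩, rfl⟩
    · have := h.le' h1
      exact ⟨⟨x, by omega⟩, ⟨Or.inl h1, Or.inl h2⟩, rfl⟩

/-- Pairs containing the hub yield the degrees of `H`. The other pairs yield 1 or 2, as `H` has no
4-cycle; both values occur, at the pairs `0, 1` (no triangle) and `0, 2` (common neighbour 1). -/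
theorem commonNeighborType_cone (h : IsArc S m n a b H) (hn : 4 ≤ n) :
    (coneGraph H n).commonNeighborType = {1, 2} ∪ ({a, b} ∪ S) := by
  have hpos := h.pos
  have hdeg : ∀ i ≤ n, (H.neighborSet i).ncard ∈ ({a, b} ∪ S : Set ℕ) := by
    intro i hi
    rcases Nat.eq_zero_or_pos i with rfl | h0
    · exact Or.inl (Or.inl h.left)
    rcases hi.eq_or_lt with rfl | h1
    · exact Or.inl (Or.inr h.right)
    · exact Or.inr (h.inner ▸ ⟨i, ⟨h0, h1⟩, rfl⟩)
  have hdeg' : ∀ i ≤ n, (H.neighborSet i).ncard ∈ (coneGraph H n).commonNeighborType := by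
    intro i hi
    refine ⟨Fin.last _, ⟨i, by omega⟩, ?_, h.ncard_commonNeighbors_last rfl hi⟩
    intro h'
    have := congrArg Fin.val h'
    simp only [Fin.val_last] at this
    omega
  ext d
  constructor
  · rintro ⟨u, v, huv, rfl⟩
    have huv' := Fin.val_ne_of_ne huv
    by_cases hu : u.val ≤ n <;> by_cases hv : v.val ≤ n
    · left
      rw [h.ncard_commonNeighbors hu hv]
      have : (H.commonNeighbors u v).ncard ≤ 1 :=
        (Set.ncard_le_one (Set.Finite.subset (h.finite_neighborSet _) Set.inter_subset_left)).2
          fun x hx y hy => h.square hx.1 hy.1 hx.2 hy.2 huv'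
      simp only [Set.mem_insert_iff, Set.mem_singleton_iff]
      omega
    · right
      rw [SimpleGraph.commonNeighbors_symm, h.ncard_commonNeighbors_last (by omega) hu]
      exact hdeg _ hu
    · right
      rw [h.ncard_commonNeighbors_last (by omega) hv]
      exact hdeg _ hv
    · omega
  · rintro ((rfl | rfl) | (rfl | rfl) | hd)
    · refine ⟨⟨0, by omega⟩, ⟨1, by omega⟩, by simp, ?_⟩
      rw [h.ncard_commonNeighbors (by simp) (by simpa using Nat.succ_le_of_lt hpos)]
      have : H.commonNeighbors 0 1 = ∅ :=
        Set.eq_empty_of_forall_notMem fun x hx =>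
          h.triangle (h.path 0 hpos) hx.2 hx.1
      simp [this]
    · refine ⟨⟨0, by omega⟩, ⟨2, by omega⟩, by simp, ?_⟩
      rw [h.ncard_commonNeighbors (Nat.zero_le _) (by simp only; omega)]
      have h1 : H.Adj 0 1 := h.path 0 hpos
      have h2 : H.Adj 2 1 := (h.path 1 (by omega)).symm
      have : H.commonNeighbors 0 2 = {1} := by
        ext x
        constructor
        · exact fun hx => h.square hx.1 h1 hx.2 h2 (by omega)
        · rintro rfl
          exact ⟨h1, h2⟩
      simp [this]
    · exact h.left ▸ hdeg' 0 (Nat.zero_le _)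
    · exact h.right ▸ hdeg' n le_rfl
    · rw [← h.inner] at hd
      obtain ⟨i, hi, rfl⟩ := hd
      exact hdeg' i hi.2.le

/-- If the hub survives, it is adjacent to everything else. Otherwise at most one vertex is lost
from the Hamiltonian cycle formed by the path and the edge `0 n`, and a path remains. -/
theorem isKConnected_cone (h : IsArc S m n a b H) (hn : 2 ≤ n) (h0n : H.Adj 0 n) :
    (coneGraph H n).IsKConnected 3 := by
  refine ⟨by simp; omega, fun T hT => ?_⟩
  set G := (coneGraph H n).induce ((T : Set (Fin (n + 2)))ᶜ) with hG
  have hGadj : ∀ u v : ((T : Set (Fin (n + 2)))ᶜ : Set _),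
      G.Adj u v ↔ (coneGraph H n).Adj u v := fun u v => Iff.rfl
  by_cases hlast : Fin.last (n + 1) ∈ T
  · have hle : ∀ u : ((T : Set (Fin (n + 2)))ᶜ : Set _), u.1.val ≤ n := by
      rintro ⟨u, hu⟩
      by_contra hu'
      have : u = Fin.last (n + 1) := Fin.ext (by simp only [Fin.val_last]; simp at hu'; omega)
      exact hu (this ▸ hlast)
    obtain ⟨x, hx⟩ : ∃ x, T.erase (Fin.last (n + 1)) ⊆ {x} := by
      rw [← Finset.card_le_one_iff_subset_singleton, Finset.card_erase_of_mem hlast]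
      omega
    have hxT : ∀ k (hk : k ≤ n), k ≠ x.val → (⟨k, by omega⟩ : Fin (n + 2)) ∉ T := by
      intro k hk hkx hkT
      have h1 := hx (Finset.mem_erase.2 ⟨by
        intro h'
        have := congrArg Fin.val h'
        simp only [Fin.val_last] at this
        omega, hkT⟩)
      exact hkx (congrArg Fin.val (Finset.mem_singleton.1 h1))
    have hinterval : ∀ (k : ℕ) (u v : ((T : Set (Fin (n + 2)))ᶜ : Set _)), v.1.val = u.1.val + k →
        (∀ j, u.1.val < j → j < v.1.val → j ≠ x.val) → G.Reachable u v := by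
      intro k
      induction k with
      | zero =>
        intro u v huv _
        rw [show u = v from Subtype.ext (Fin.ext huv.symm)]
      | succ k ih =>
        intro u v huv hux
        have hv := hle v
        rcases Nat.eq_zero_or_pos k with rfl | hk
        · refine SimpleGraph.Adj.reachable ((hGadj _ _).2 (Or.inl ?_))
          rw [huv]
          exact h.path _ (by omega)
        · refine (ih u ⟨⟨u.1.val + k, by omega⟩, hxT _ (by omega) (hux _ (by omega)
            (by omega))⟩ rfl fun j hj hj' => hux j hj (by simp only at hj'; omega)).trans
            (SimpleGraph.Adj.reachable ((hGadj _ _).2 (Or.inl ?_)))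
          have := h.path (u.1.val + k) (by omega)
          rwa [add_assoc, ← huv] at this
    have hlt : ∀ u v : ((T : Set (Fin (n + 2)))ᶜ : Set _), u.1.val ≤ v.1.val →
        G.Reachable u v := by
      intro u v huv
      have hv := hle v
      obtain ⟨k, hk⟩ := Nat.exists_eq_add_of_le huv
      -- If `x` separates `u` from `v` on the path, the route goes the other way round the cycle,
      -- through the edge `0 n`.
      by_cases hx' : u.1.val < x.val ∧ x.val < v.1.val
      · let z : ((T : Set (Fin (n + 2)))ᶜ : Set _) :=
          ⟨⟨0, by omega⟩, hxT 0 (by omega) (by omega)⟩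
        let l : ((T : Set (Fin (n + 2)))ᶜ : Set _) :=
          ⟨⟨n, by omega⟩, hxT n (by omega) (by omega)⟩
        have h1 : G.Reachable z u :=
          hinterval u.1.val z u (Nat.zero_add _).symm (fun j _ hj' => by omega)
        have h2 : G.Reachable z l := SimpleGraph.Adj.reachable ((hGadj _ _).2 (Or.inl h0n))
        have h3 : G.Reachable v l :=
          hinterval (n - v.1.val) v l (by simp only [l]; omega) (fun j hj _ => by omega)
        exact h1.symm.trans (h2.trans h3.symm)
      · exact hinterval k u v hk (fun j hj hj' hjx => hx' (by omega))
    have hnonempty : Nonempty ((T : Set (Fin (n + 2)))ᶜ : Set _) := by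
      by_cases hx0 : x.val = 0
      · exact ⟨⟨⟨1, by omega⟩, hxT 1 (by omega) (by omega)⟩⟩
      · exact ⟨⟨⟨0, by omega⟩, hxT 0 (by omega) (by omega)⟩⟩
    exact ⟨fun u v => (le_total u.1.val v.1.val).elim (hlt u v) fun h' => (hlt v u h').symm⟩
  · let c : ((T : Set (Fin (n + 2)))ᶜ : Set _) := ⟨Fin.last (n + 1), hlast⟩
    have hc : ∀ u, G.Reachable c u := by
      intro u
      by_cases hu : u.1.val ≤ n
      · exact SimpleGraph.Adj.reachable ((hGadj _ _).2 ((h.cone_adj_last rfl).2 hu))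
      · rw [show c = u from Subtype.ext (Fin.ext (by simp only [c, Fin.val_last]; omega))]
    have : Nonempty ((T : Set (Fin (n + 2)))ᶜ : Set _) := ⟨c⟩
    exact ⟨fun u v => (hc u).symm.trans (hc v)⟩

end IsArc

/-! ### Drawing the cone with its rim on a parabola. -/

theorem mem_segment_prod {P Q x : ℝ × ℝ} (h : x ∈ segment ℝ P Q) :
    ∃ t : ℝ, 0 ≤ t ∧ t ≤ 1 ∧ x.1 = P.1 + t * (Q.1 - P.1) ∧ x.2 = P.2 + t * (Q.2 - P.2) := by
  obtain ⟨s, t, hs, ht, hst, rfl⟩ := h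
  refine ⟨t, ht, by linarith, ?_, ?_⟩ <;>
  · obtain rfl : s = 1 - t := by linarith
    simp
    ring

/-- A point of a chord of the parabola. -/
theorem mem_chord {i j : ℝ} (hij : i < j) {x : ℝ × ℝ}
    (h : x ∈ segment ℝ (i, i ^ 2) (j, j ^ 2)) :
    i ≤ x.1 ∧ x.1 ≤ j ∧ x.2 = x.1 ^ 2 + (x.1 - i) * (j - x.1) := by
  obtain ⟨t, h0, h1, hx, hy⟩ := mem_segment_prod h
  simp only at hx hy
  refine ⟨by nlinarith, by nlinarith, ?_⟩
  rw [hy, hx]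
  ring

/-- A point of a segment from a point far below the parabola to the parabola. -/
theorem mem_spoke {M i : ℝ} (hM : i ^ 2 < M) {x : ℝ × ℝ}
    (h : x ∈ segment ℝ (0, -M) (i, i ^ 2)) :
    ∃ t : ℝ, 0 ≤ t ∧ t ≤ 1 ∧ x.1 = t * i ∧ x.2 = -M + t * (i ^ 2 + M) ∧
      (x.1 ^ 2 ≤ x.2 → t = 1) := by
  obtain ⟨t, h0, h1, hx, hy⟩ := mem_segment_prod h
  simp only at hx hy
  refine ⟨t, h0, h1, by linarith, by linarith, fun h' => ?_⟩
  by_contra ht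
  have ht' : 0 < 1 - t := by
    have := lt_of_le_of_ne h1 ht
    linarith
  -- As `M > i ^ 2`, this is negative for `t < 1`: the spoke stays strictly below the parabola until
  -- its end.
  have h2 : x.2 - x.1 ^ 2 = (1 - t) * (t * i ^ 2 - M) := by
    rw [hx, hy]
    ring
  have h3 : t * i ^ 2 - M < 0 := by nlinarith [sq_nonneg i]
  nlinarith

/-- Two chords of the parabola that do not cross meet only in a common end. -/
theorem chord_inter {i j k l : ℝ} (hij : i < j) (hkl : k < l) (hne : ¬ (i = k ∧ j = l))
    (h₁ : ¬ (i < k ∧ k < j ∧ j < l)) (h₂ : ¬ (k < i ∧ i < l ∧ l < j)) {x : ℝ × ℝ}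
    (hx : x ∈ segment ℝ (i, i ^ 2) (j, j ^ 2)) (hx' : x ∈ segment ℝ (k, k ^ 2) (l, l ^ 2)) :
    (x = (i, i ^ 2) ∨ x = (j, j ^ 2)) ∧ (x = (k, k ^ 2) ∨ x = (l, l ^ 2)) := by
  obtain ⟨a1, a2, a3⟩ := mem_chord hij hx
  obtain ⟨b1, b2, b3⟩ := mem_chord hkl hx'
  obtain ⟨y, z⟩ := x
  simp only at a1 a2 a3 b1 b2 b3
  -- Both sides are the height above the parabola. Over a common inner point, the chord of a
  -- strictly larger interval is strictly higher.
  have heq : (y - i) * (j - y) = (y - k) * (l - y) := by linarith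
  have key : (y = i ∨ y = j) ∧ (y = k ∨ y = l) := by
    by_cases hy : y = i ∨ y = j
    · refine ⟨hy, ?_⟩
      have h0 : (y - i) * (j - y) = 0 := by rcases hy with rfl | rfl <;> ring
      rw [heq, mul_eq_zero] at h0
      rcases h0 with h0 | h0
      · left; linarith
      · right; linarith
    · exfalso
      push Not at hy
      have c1 : i < y := lt_of_le_of_ne a1 hy.1.symm
      have c2 : y < j := lt_of_le_of_ne a2 hy.2
      have hp : 0 < (y - k) * (l - y) := heq ▸ mul_pos (by linarith) (by linarith)
      have d1 : k < y := lt_of_le_of_ne b1 (by rintro rfl; simp at hp)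
      have d2 : y < l := lt_of_le_of_ne b2 (by rintro rfl; simp at hp)
      rcases lt_trichotomy i k with h | h | h
      · have : l ≤ j := by
          by_contra h'
          exact h₁ ⟨h, by linarith, by linarith⟩
        nlinarith
      · subst h
        exact hne ⟨rfl, by
          have := mul_left_cancel₀ (by linarith : y - i ≠ 0) heq
          linarith⟩
      · have : j ≤ l := by
          by_contra h'
          exact h₂ ⟨h, by linarith, by linarith⟩
        nlinarith
  have hz : z = y ^ 2 := by
    rcases key.1 with rfl | rfl
    · linarith
    · linarith
  subst hz
  simp only [Prod.mk.injEq]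
  exact ⟨key.1.imp (fun h => ⟨h, by rw [h]⟩) fun h => ⟨h, by rw [h]⟩,
    key.2.imp (fun h => ⟨h, by rw [h]⟩) fun h => ⟨h, by rw [h]⟩⟩

/-- Two spokes meet only in the hub. -/
theorem spoke_inter {M i j : ℝ} (hM : i ^ 2 < M) (hM' : j ^ 2 < M)
    (hij : i ≠ j) {x : ℝ × ℝ} (hx : x ∈ segment ℝ (0, -M) (i, i ^ 2))
    (hx' : x ∈ segment ℝ (0, -M) (j, j ^ 2)) : x = (0, -M) := by
  obtain ⟨t, -, -, tx, ty, -⟩ := mem_spoke hM hx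
  obtain ⟨s, -, -, sx, sy, -⟩ := mem_spoke hM' hx'
  have e1 : t * i = s * j := by linarith
  have e2 : t * (i ^ 2 + M) = s * (j ^ 2 + M) := by linarith
  -- The factor after `t` is the determinant of the two spoke directions; it is nonzero because `2 *
  -- i * j ≤ i ^ 2 + j ^ 2 < 2 * M`.
  have e3 : t * ((j - i) * (i * j - M)) = 0 := by
    linear_combination (j ^ 2 + M) * e1 - j * e2
  have hlt : i * j - M < 0 := by nlinarith [sq_nonneg (i - j)]
  have ht : t = 0 := by
    rcases mul_eq_zero.1 e3 with h | h
    · exact h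
    · rcases mul_eq_zero.1 h with h | h
      · exact absurd (by linarith) hij
      · exact absurd h hlt.ne
  subst ht
  exact Prod.ext (by simpa using tx) (by simpa using ty)

/-- A spoke and a chord meet only in a common end. -/
theorem spoke_chord_inter {M i j k : ℝ} (hM : k ^ 2 < M) (hij : i < j) {x : ℝ × ℝ}
    (hx : x ∈ segment ℝ (0, -M) (k, k ^ 2)) (hx' : x ∈ segment ℝ (i, i ^ 2) (j, j ^ 2)) :
    x = (k, k ^ 2) ∧ (k = i ∨ k = j) := by
  obtain ⟨t, -, -, tx, ty, ht⟩ := mem_spoke hM hx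
  obtain ⟨a1, a2, a3⟩ := mem_chord hij hx'
  have hnn : 0 ≤ (x.1 - i) * (j - x.1) := mul_nonneg (by linarith) (by linarith)
  obtain rfl := ht (by linarith)
  have h1 : x.1 = k := by linarith
  have h2 : x.2 = k ^ 2 := by linarith
  refine ⟨Prod.ext h1 h2, ?_⟩
  rw [h1, h2] at a3
  have : (k - i) * (j - k) = 0 := by linarith
  rcases mul_eq_zero.1 this with h | h
  · left; linarith
  · right; linarith

/-- The positions of the vertices of the cone: the hub lies far below the parabola, which carries
the other vertices. -/
noncomputable def conePosition (n : ℕ) (v : Fin (n + 2)) : ℝ × ℝ :=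
  if v.val = n + 1 then (0, -((n : ℝ) ^ 2 + 1)) else ((v.val : ℝ), (v.val : ℝ) ^ 2)

theorem conePosition_last {n : ℕ} {v : Fin (n + 2)} (hv : v.val = n + 1) :
    conePosition n v = (0, -((n : ℝ) ^ 2 + 1)) := if_pos hv

theorem conePosition_of_le {n : ℕ} {v : Fin (n + 2)} (hv : v.val ≤ n) :
    conePosition n v = ((v.val : ℝ), (v.val : ℝ) ^ 2) := if_neg (by omega)

theorem sq_lt_of_le {n i : ℕ} (hi : i ≤ n) : (i : ℝ) ^ 2 < (n : ℝ) ^ 2 + 1 := by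
  have : (i : ℝ) ^ 2 ≤ (n : ℝ) ^ 2 := by gcongr
  linarith

theorem conePosition_injective (n : ℕ) : Function.Injective (conePosition n) := by
  intro u v huv
  have hneg : ∀ i : ℕ, (i : ℝ) ^ 2 ≠ -((n : ℝ) ^ 2 + 1) := fun i h => by
    have := sq_nonneg (i : ℝ)
    have := sq_nonneg (n : ℝ)
    linarith
  by_cases hu : u.val ≤ n <;> by_cases hv : v.val ≤ n
  · rw [conePosition_of_le hu, conePosition_of_le hv, Prod.mk.injEq] at huv
    exact Fin.ext (by exact_mod_cast huv.1)
  · rw [conePosition_of_le hu, conePosition_last (by omega), Prod.mk.injEq] at huv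
    exact absurd huv.2 (hneg _)
  · rw [conePosition_last (by omega), conePosition_of_le hv, Prod.mk.injEq] at huv
    exact absurd huv.2.symm (hneg _)
  · exact Fin.ext (by omega)

namespace IsArc

variable {S : Set ℕ} {m n a b : ℕ} {H : SimpleGraph ℕ}

/-- Every edge of the cone is, up to orientation, a spoke or an edge of the arc. -/
theorem cone_edge_cases (h : IsArc S m n a b H) {u v : Fin (n + 2)}
    (huv : (coneGraph H n).Adj u v) :
    ∃ c d : Fin (n + 2), s(u, v) = s(c, d) ∧ d.val ≤ n ∧
      (c.val = n + 1 ∨ c.val < d.val ∧ H.Adj c d) := by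
  rcases huv with h' | h' | h'
  · rcases lt_or_gt_of_ne h'.ne with hlt | hlt
    · exact ⟨u, v, rfl, h.le' h', Or.inr ⟨hlt, h'⟩⟩
    · exact ⟨v, u, Sym2.eq_swap, h.le h', Or.inr ⟨hlt, h'.symm⟩⟩
  · exact ⟨u, v, rfl, h'.2, Or.inl h'.1⟩
  · exact ⟨v, u, Sym2.eq_swap, h'.2, Or.inl h'.1⟩

/-- Edges of `H` become chords of the parabola, which do not cross by `noncrossing`; spokes reach
the parabola from below, while chords lie on or above it. -/
theorem isPlanar_cone (h : IsArc S m n a b H) : (coneGraph H n).IsPlanar := by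
  have hinj := conePosition_injective n
  have hseg : ∀ {u v c d : Fin (n + 2)}, s(u, v) = s(c, d) →
      segment ℝ (conePosition n u) (conePosition n v) =
        segment ℝ (conePosition n c) (conePosition n d) := by
    intro u v c d huv
    rcases Sym2.eq_iff.1 huv with ⟨rfl, rfl⟩ | ⟨rfl, rfl⟩
    · rfl
    · exact segment_symm _ _ _
  have hends : ∀ {u v c d w : Fin (n + 2)}, s(u, v) = s(c, d) → (w = c ∨ w = d) →
      (w = u ∨ w = v) := by
    intro u v c d w huv hw
    rwa [← Sym2.mem_iff, huv, Sym2.mem_iff]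
  have hmain : ∀ u v u' v', (coneGraph H n).Adj u v → (coneGraph H n).Adj u' v' →
      s(u, v) ≠ s(u', v') → ∀ x ∈ segment ℝ (conePosition n u) (conePosition n v),
      x ∈ segment ℝ (conePosition n u') (conePosition n v') →
        ∃ w, (w = u ∨ w = v) ∧ (w = u' ∨ w = v') ∧ conePosition n w = x := by
    intro u v u' v' huv huv' hne x hx hx'
    obtain ⟨c, d, he, hd, hcd⟩ := h.cone_edge_cases huv
    obtain ⟨c', d', he', hd', hcd'⟩ := h.cone_edge_cases huv'
    rw [hseg he] at hx
    rw [hseg he'] at hx'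
    rw [he, he'] at hne
    suffices hw : ∃ w, (w = c ∨ w = d) ∧ (w = c' ∨ w = d') ∧ conePosition n w = x by
      obtain ⟨w, h1, h2, h3⟩ := hw
      exact ⟨w, hends he h1, hends he' h2, h3⟩
    rw [conePosition_of_le hd] at hx
    rw [conePosition_of_le hd'] at hx'
    rcases hcd with hc | ⟨hlt, hc⟩ <;> rcases hcd' with hc' | ⟨hlt', hc'⟩
    · obtain rfl : c = c' := Fin.ext (by omega)
      rw [conePosition_last hc] at hx hx'
      have hdd : (d.val : ℝ) ≠ d'.val := fun h' => hne (by
        rw [show d = d' from Fin.ext (by exact_mod_cast h')])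
      refine ⟨c, Or.inl rfl, Or.inl rfl, ?_⟩
      rw [conePosition_last hc]
      exact (spoke_inter (sq_lt_of_le hd)
        (sq_lt_of_le hd') hdd hx hx').symm
    · rw [conePosition_last hc] at hx
      rw [conePosition_of_le (by omega)] at hx'
      obtain ⟨rfl, h2⟩ := spoke_chord_inter (sq_lt_of_le hd) (by exact_mod_cast hlt') hx hx'
      exact ⟨d, Or.inr rfl, h2.imp (fun h' => Fin.ext (by exact_mod_cast h'))
        fun h' => Fin.ext (by exact_mod_cast h'), conePosition_of_le hd⟩
    · rw [conePosition_last hc'] at hx'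
      rw [conePosition_of_le (by omega)] at hx
      obtain ⟨rfl, h2⟩ := spoke_chord_inter (sq_lt_of_le hd') (by exact_mod_cast hlt) hx' hx
      exact ⟨d', h2.imp (fun h' => Fin.ext (by exact_mod_cast h'))
        fun h' => Fin.ext (by exact_mod_cast h'), Or.inr rfl, conePosition_of_le hd'⟩
    · rw [conePosition_of_le (by omega)] at hx hx'
      have hI := chord_inter (by exact_mod_cast hlt) (by exact_mod_cast hlt')
        (fun h' => hne (by
          rw [show c = c' from Fin.ext (by exact_mod_cast h'.1),
            show d = d' from Fin.ext (by exact_mod_cast h'.2)]))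
        (fun h' => h.noncrossing hc hc' (by exact_mod_cast h'.1) (by exact_mod_cast h'.2.1)
          (by exact_mod_cast h'.2.2))
        (fun h' => h.noncrossing hc' hc (by exact_mod_cast h'.1) (by exact_mod_cast h'.2.1)
          (by exact_mod_cast h'.2.2)) hx hx'
      rw [← conePosition_of_le hd, ← conePosition_of_le hd', ← conePosition_of_le (v := c)
        (by omega), ← conePosition_of_le (v := c') (by omega)] at hI
      rcases hI.1 with rfl | rfl
      · exact ⟨c, Or.inl rfl, hI.2.imp (fun h' => hinj h') fun h' => hinj h', rfl⟩
      · exact ⟨d, Or.inr rfl, hI.2.imp (fun h' => hinj h') fun h' => hinj h', rfl⟩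
  refine IsPlanar.of_segments _ hinj ?_ hmain
  intro u v huv w hw
  by_contra hne
  push Not at hne
  -- an edge at `w` other than `uv`, on which `w` lies as well
  obtain ⟨z, hz⟩ : ∃ z, (coneGraph H n).Adj w z := by
    by_cases hwn : w.val ≤ n
    · exact ⟨Fin.last _, (cone_adj hwn).2 (Or.inr rfl)⟩
    · exact ⟨⟨0, by omega⟩, (h.cone_adj_last (by omega)).2 (Nat.zero_le _)⟩
  obtain ⟨y, hy, -, hyw⟩ := hmain u v w z huv hz (fun h' => by
    have := Sym2.mem_mk_left w z
    rw [← h', Sym2.mem_iff] at this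
    tauto) _ hw (left_mem_segment ℝ _ _)
  have := hinj hyw
  subst this
  tauto

end IsArc

theorem mainTheorem11 (A' : Finset ℕ) (hne : A'.Nonempty) (hA' : ∀ a ∈ A', 5 ≤ a) :
    ∃ (n : ℕ → ℕ) (G : (i : ℕ) → SimpleGraph (Fin (n i))),
      (∀ i j : ℕ, i ≠ j → IsEmpty (G i ≃g G j)) ∧
      ∀ i : ℕ, (G i).IsPolyhedron ∧
        (G i).commonNeighborType = ({1, 2, 4} : Set ℕ) ∪ (A' : Set ℕ) := by
  obtain ⟨N, hN, hG⟩ := exists_isArc A' hA'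
  choose H hH hH0 using hG
  refine ⟨fun t => N + t + 2, fun t => coneGraph (H t) (N + t), ?_, fun t => ⟨⟨?_, ?_⟩, ?_⟩⟩
  · refine fun i j hij => ⟨fun e => hij ?_⟩
    have := Fintype.card_congr e.toEquiv
    simp only [Fintype.card_fin] at this
    omega
  · exact (hH t).isPlanar_cone
  · exact (hH t).isKConnected_cone (by omega) (hH0 t)
  · rw [(hH t).commonNeighborType_cone (by omega)]
    ext x
    simp only [Set.mem_union, Set.mem_insert_iff, Set.mem_singleton_iff]
    tauto
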